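/- Let $\mathbb{T}^d=\mathbb{R}^d/\mathbb{Z}^d$ be the torus with its flat Euclidean metric, let $(g_n)$ be a sequence of subsets of $\mathbb{T}^d$ with diameters $l_n=\operatorname{diam}(g_n)$, and let $(\xi_n)$ be independent random variables uniformly distributed on $\mathbb{T}^d$. Assume that either every $g_n$ is an (open or closed) ball of positive radius centred at $0$, or the $g_n$ are ball-like, meaning that $$\lim_{n\to\infty}\frac{\log \operatorname{inrad}(g_n)}{\log l_n}=1,$$ where $\operatorname{inrad}(g_n)$ is the supremum of the radii (at most $\operatorname{diam}\mathbb{T}^d$) of the balls contained in $g_n$. Let $$E=\limsup_{n\to\infty}(g_n+\xi_n)=\bigcap_{n}\bigcup_{k\ge n}(g_k+\xi_k)$$ be the random covering set. Let $\alpha$ be the almost sure Hausdorff dimension of $E$ (that is, $\dim_H E=\alpha$ almost surely), or let $\alpha=\sup\{0\le s\le d:\sum_{n}l_n^s=\infty\}$, which is the usual formula for this dimension; the result holds for either reading of $\alpha$. If $F\subset\mathbb{T}^d$ is an analytic set with $\dim_H F>d-\alpha$, then $E\cap F\neq\emptyset$ almost surely. No regularity condition on $(l_n)$ is assumed. -/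

import Mathlib

open MeasureTheory ProbabilityTheory Filter Topology Set
open scoped ENNReal NNReal

/-- The `d`-dimensional torus `ℝ^d / ℤ^d` with its flat Euclidean metric. -/
abbrev Torus (d : ℕ) : Type := PiLp 2 (fun _ : Fin d => UnitAddCircle)

/-- The uniform distribution (normalised Lebesgue measure) on the torus: the product of the
Lebesgue measures of the circles `ℝ / ℤ`. -/
noncomputable def uniformTorus (d : ℕ) : Measure (Torus d) :=
  (volume : Measure (Fin d → UnitAddCircle)).map (WithLp.toLp 2)

/-- The covering set `limsup (g n + x n)`: the points that lie in infinitely many of the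
translates `g n + x n`. -/
def coveringSet {d : ℕ} (g : ℕ → Set (Torus d)) (x : ℕ → Torus d) : Set (Torus d) :=
  ⋂ n : ℕ, ⋃ k ≥ n, (fun y => y + x k) '' g k

/-- The inradius of `A`: the supremum of the radii of the balls contained in `A`. (A ball whose
radius exceeds the diameter of the torus is the whole torus, so only radii up to this diameter are
considered.) -/
noncomputable def inradius {d : ℕ} (A : Set (Torus d)) : ℝ :=
  sSup {r : ℝ | 0 ≤ r ∧ r ≤ Metric.diam (univ : Set (Torus d)) ∧ ∃ c, Metric.ball c r ⊆ A}

/-- All the `g n` are (open or closed) balls centred at the origin, of positive radius. -/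
def IsBallSequence {d : ℕ} (g : ℕ → Set (Torus d)) : Prop :=
  ∀ n, ∃ r : ℝ, 0 < r ∧ (g n = Metric.ball 0 r ∨ g n = Metric.closedBall 0 r)

/-- The sets `g n` are ball-like: `log (inradius (g n)) / log (diam (g n)) → 1`. -/
def IsBallLikeSequence {d : ℕ} (g : ℕ → Set (Torus d)) : Prop :=
  Tendsto (fun n => Real.log (inradius (g n)) / Real.log (Metric.diam (g n))) atTop (𝓝 1)

/-- The exponent `sup {0 ≤ s ≤ d : ∑ n, (l n) ^ s = ∞}` of a sequence of nonnegative reals. -/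
noncomputable def coveringExponent (d : ℕ) (l : ℕ → ℝ) : ℝ≥0∞ :=
  ⨆ s ∈ {s : ℝ≥0 | s ≤ d ∧ ¬ Summable (fun n => l n ^ (s : ℝ))}, (s : ℝ≥0∞)

/-! The proof combines a second-moment-free hitting estimate with Baire category. Inside `g k` sits
a ball, so it suffices to treat independent balls of radii `r k` with `∑ r k ^ s = ∞` for some `s`
with `d - s < dimH F`.

A ball hits a fixed set `A` exactly when its centre lies in the `r k`-neighbourhood of `A`. If the
volumes of these neighbourhoods were summable, infinitely many would be below `r k ^ s`; packing at
those scales covers `A` by `O(r k ^ (s - d))` balls, so `dimH A ≤ d - s`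
(`tsum_measure_thickening_eq_top`). Hence, by the second Borel–Cantelli lemma, every `A` of larger
dimension is almost surely hit infinitely often. Only infinitely many good scales are needed, so `r`
may be irregular.

To get one point in infinitely many balls, write `F` as a continuous image of a Polish space and
discard the open sets with small image. Almost surely all of the countably many basic portions of
the remainder are hit infinitely often, so the tail unions pull back to dense open sets, and Baire
applies (`ae_exists_mem_frequently_of_lt_dimH`).

Both readings of `α` reduce to the exponent, since `dimH E` never exceeds it. -/

/-- The points all of whose neighbourhoods have an image of dimension larger than `t` form a closed
set which is nonempty and whose relatively open portions have images of dimension larger than `t`. -/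
theorem exists_isClosed_forall_isOpen_lt_dimH_image {X Y : Type*} [TopologicalSpace X]
    [SecondCountableTopology X] [EMetricSpace Y] (f : X → Y) {t : ℝ≥0∞}
    (ht : t < dimH (range f)) :
    ∃ C : Set X, IsClosed C ∧ C.Nonempty ∧
      ∀ U, IsOpen U → (U ∩ C).Nonempty → t < dimH (f '' (U ∩ C)) := by
  set S := {U ∈ TopologicalSpace.countableBasis X | dimH (f '' U) ≤ t} with hS
  have hScount : S.Countable := (TopologicalSpace.countable_countableBasis X).mono fun _ h => h.1
  have hSle : dimH (f '' ⋃₀ S) ≤ t := by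
    rw [sUnion_eq_biUnion, image_iUnion₂, dimH_bUnion hScount]
    exact iSup₂_le fun U hU => hU.2
  have hSopen : IsOpen (⋃₀ S) :=
    isOpen_sUnion fun U hU => TopologicalSpace.isOpen_of_mem_countableBasis hU.1
  refine ⟨(⋃₀ S)ᶜ, hSopen.isClosed_compl, ?_, fun U hU hne => ?_⟩
  · rw [nonempty_compl]
    intro h
    rw [h, image_univ] at hSle
    exact ht.not_ge hSle
  · by_contra! hle
    obtain ⟨x, hxU, hxC⟩ := hne
    obtain ⟨V, hV, hxV, hVU⟩ :=
      (TopologicalSpace.isBasis_countableBasis X).exists_subset_of_mem_open hxU hU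
    refine hxC ⟨V, ⟨hV, ?_⟩, hxV⟩
    calc dimH (f '' V) ≤ dimH (f '' (U ∩ (⋃₀ S)ᶜ) ∪ f '' ⋃₀ S) := by
          refine dimH_mono ?_
          rw [← image_union]
          refine image_mono fun y hy => ?_
          by_cases h : y ∈ ⋃₀ S
          · exact Or.inr h
          · exact Or.inl ⟨hVU hy, h⟩
      _ ≤ t := by rw [dimH_union]; exact max_le hle hSle

/-- Hitting criterion: if almost surely every set of dimension larger than `t` meets infinitely many
of the random open sets `B k`, then the limsup of the `B k` meets every analytic set of dimension
larger than `t`. -/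
theorem ae_exists_mem_frequently_of_lt_dimH {X Ω : Type*} [EMetricSpace X] [MeasurableSpace Ω]
    {P : Measure Ω} {B : ℕ → Ω → Set X} (hB : ∀ k ω, IsOpen (B k ω)) {t : ℝ≥0∞}
    (hhit : ∀ A : Set X, t < dimH A → ∀ᵐ ω ∂P, ∃ᶠ k in atTop, (B k ω ∩ A).Nonempty)
    {F : Set X} (hF : AnalyticSet F) (ht : t < dimH F) :
    ∀ᵐ ω ∂P, ∃ x ∈ F, ∃ᶠ k in atTop, x ∈ B k ω := by
  rw [analyticSet_iff_exists_polishSpace_range] at hF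
  obtain ⟨Y, _, _, f, hf, rfl⟩ := hF
  obtain ⟨C, hC, hCne, hCdim⟩ := exists_isClosed_forall_isOpen_lt_dimH_image f ht
  have : PolishSpace C := hC.polishSpace
  have : Nonempty C := hCne.to_subtype
  set 𝓑 := TopologicalSpace.countableBasis Y
  have h : ∀ᵐ ω ∂P, ∀ U ∈ 𝓑, (U ∩ C).Nonempty →
      ∃ᶠ k in atTop, (B k ω ∩ f '' (U ∩ C)).Nonempty := by
    refine (ae_ball_iff (TopologicalSpace.countable_countableBasis Y)).2 fun U hU => ?_
    by_cases hne : (U ∩ C).Nonempty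
    · filter_upwards [hhit _ (hCdim U (TopologicalSpace.isOpen_of_mem_countableBasis hU) hne)]
        with ω hω _ using hω
    · exact .of_forall fun _ h => absurd h hne
  filter_upwards [h] with ω hω
  let G : ℕ → Set C := fun n => ⋃ k ≥ n, (fun y : C => f y) ⁻¹' B k ω
  have hfC : Continuous fun y : C => f y := hf.comp continuous_subtype_val
  have hGo : ∀ n, IsOpen (G n) := fun n =>
    isOpen_biUnion fun k _ => (hB k ω).preimage hfC
  have hGd : ∀ n, Dense (G n) := by
    refine fun n => dense_iff_inter_open.2 fun V hV ⟨y, hy⟩ => ?_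
    obtain ⟨W, hW, rfl⟩ := isOpen_induced_iff.1 hV
    obtain ⟨U, hU, hyU, hUW⟩ :=
      (TopologicalSpace.isBasis_countableBasis Y).exists_subset_of_mem_open hy hW
    obtain ⟨k, hk, z, hzB, w, ⟨hwU, hwC⟩, rfl⟩ :=
      frequently_atTop.1 (hω U hU ⟨y, hyU, y.2⟩) n
    exact ⟨⟨w, hwC⟩, hUW hwU, mem_biUnion hk hzB⟩
  obtain ⟨y, hy⟩ := (dense_iInter_of_isOpen_nat hGo hGd).nonempty
  refine ⟨f y, mem_range_self _, frequently_atTop.2 fun n => ?_⟩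
  obtain ⟨k, hk, hyk⟩ := mem_iUnion₂.1 (mem_iInter.1 hy n)
  exact ⟨k, hk, hyk⟩

/-! ### Packing, neighbourhood volumes and Borel–Cantelli -/

theorem exists_isSeparated_isCover {X : Type*} [PseudoEMetricSpace X] (ε : ℝ≥0) (A : Set X) :
    ∃ C ⊆ A, Metric.IsSeparated ε C ∧ Metric.IsCover ε A C := by
  obtain ⟨C, hC⟩ := zorn_subset {N : Set X | N ⊆ A ∧ Metric.IsSeparated ε N} fun c hc hchain =>
    ⟨⋃₀ c, ⟨sUnion_subset fun N hN => (hc hN).1,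
      (pairwise_sUnion hchain.directedOn).2 fun N hN => (hc hN).2⟩, fun N hN =>
      subset_sUnion_of_mem hN⟩
  exact ⟨C, hC.prop.1, hC.prop.2, Metric.IsCover.of_maximal_isSeparated hC⟩

/-- The volume of the `r`-neighbourhood of `A` controls the size of some cover of `A` by sets of
diameter at most `2 * r`. -/
theorem exists_countable_cover_tsum_le_measure_thickening {X : Type*} [MetricSpace X]
    [SecondCountableTopology X] [MeasurableSpace X] [BorelSpace X] (μ : Measure X) (A : Set X)
    {r : ℝ≥0} (hr : 0 < r) {v : ℝ≥0∞} (hv : ∀ x, v ≤ μ (Metric.ball x (r / 2 : ℝ≥0))) :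
    ∃ C : Set X, C.Countable ∧ A ⊆ ⋃ x : C, Metric.closedBall (x : X) r ∧
      ∑' _ : C, v ≤ μ (Metric.thickening r A) := by
  obtain ⟨C, hCA, hsep, hcov⟩ := exists_isSeparated_isCover r A
  have hdisj : C.PairwiseDisjoint fun x => Metric.ball x (r / 2 : ℝ≥0) := by
    intro x hx y hy hxy
    refine Metric.ball_disjoint_ball ?_
    have h : (r : ℝ≥0∞) < edist x y := hsep hx hy hxy
    rw [edist_nndist, ENNReal.coe_lt_coe] at h
    rw [← NNReal.coe_add, add_halves]
    exact_mod_cast h.le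
  have hCc : C.Countable := hdisj.countable_of_isOpen (fun _ _ => Metric.isOpen_ball)
    fun x _ => ⟨x, Metric.mem_ball_self (by positivity)⟩
  have := hCc.to_subtype
  refine ⟨C, hCc, fun x hx => ?_, ?_⟩
  · obtain ⟨y, hy, hxy⟩ := hcov hx
    refine mem_iUnion.2 ⟨⟨y, hy⟩, ?_⟩
    rw [Metric.mem_closedBall, ← coe_nndist]
    have : edist x y ≤ r := hxy
    rw [edist_nndist, ENNReal.coe_le_coe] at this
    exact_mod_cast this
  · calc ∑' _ : C, v ≤ ∑' x : C, μ (Metric.ball (x : X) (r / 2 : ℝ≥0)) :=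
          ENNReal.tsum_le_tsum fun x => hv x
      _ = μ (⋃ x : C, Metric.ball (x : X) (r / 2 : ℝ≥0)) :=
          (measure_iUnion ((pairwise_subtype_iff_pairwise_set C _).2 hdisj)
            fun _ => measurableSet_ball).symm
      _ ≤ μ (Metric.thickening r A) := by
          refine measure_mono (iUnion_subset fun x => ?_)
          refine (Metric.ball_subset_ball ?_).trans (Metric.ball_subset_thickening (hCA x.2) _)
          exact_mod_cast half_le_self hr.le

theorem tsum_measure_thickening_eq_top {X : Type*} [MetricSpace X] [SecondCountableTopology X]
    [MeasurableSpace X] [BorelSpace X] {μ : ℕ → Measure X} {κ d s : ℝ≥0} (hκ : κ ≠ 0) (hsd : s ≤ d)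
    (hμ : ∀ k x (ρ : ℝ≥0), 0 < ρ → ρ ≤ 1 → ((κ * ρ ^ (d : ℝ) : ℝ≥0) : ℝ≥0∞) ≤
      μ k (Metric.ball x ρ))
    {r : ℕ → ℝ≥0} (hr : ∀ᶠ k in atTop, 0 < r k) (hsum : ¬ Summable fun k => r k ^ (s : ℝ))
    {A : Set X} (hA : (d : ℝ≥0∞) - s < dimH A) :
    ∑' k, μ k (Metric.thickening (r k) A) = ∞ := by
  by_contra hV
  obtain ⟨a, ha⟩ : A.Nonempty := by
    rw [nonempty_iff_ne_empty]
    rintro rfl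
    simp at hA
  have hV0 := ENNReal.tendsto_atTop_zero_of_tsum_ne_top hV
  -- Otherwise the neighbourhoods infinitely often contain a fixed ball about `a`, whose mass is
  -- bounded below.
  have hr0 : Tendsto (fun k => (r k : ℝ≥0∞)) atTop (𝓝 0) := by
    rw [← ENNReal.coe_zero, ENNReal.tendsto_coe]
    refine tendsto_order.2 ⟨fun _ h => absurd h not_lt_zero, fun ε hε => ?_⟩
    have hε' : 0 < min ε 1 := lt_min hε one_pos
    have hpos : (0 : ℝ≥0∞) < (κ * min ε 1 ^ (d : ℝ) : ℝ≥0) :=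
      ENNReal.coe_pos.2 (mul_pos (pos_iff_ne_zero.2 hκ) (NNReal.rpow_pos hε'))
    filter_upwards [(tendsto_order.1 hV0).2 _ hpos] with k hk
    by_contra! hle
    refine hk.not_ge ((hμ k a _ hε' (min_le_right _ _)).trans (measure_mono ?_))
    refine (Metric.ball_subset_ball ?_).trans (Metric.ball_subset_thickening ha _)
    exact_mod_cast (min_le_left _ _).trans hle
  have hfreq : ∃ᶠ k in atTop, μ k (Metric.thickening (r k) A) < (r k ^ (s : ℝ) : ℝ≥0) := by
    by_contra h
    rw [not_frequently] at h
    obtain ⟨N, hN⟩ := eventually_atTop.1 h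
    refine hsum ((NNReal.summable_nat_add_iff N).1 (ENNReal.tsum_coe_ne_top_iff_summable.1 ?_))
    refine ne_top_of_le_ne_top hV (le_trans ?_ (ENNReal.tsum_comp_le_tsum_of_injective
      (add_left_injective N) fun k => μ k (Metric.thickening (r k) A)))
    exact ENNReal.tsum_le_tsum fun k => not_lt.1 (hN _ (Nat.le_add_left _ _))
  have hcov : ∀ k, ∃ C : Set X, C.Countable ∧ (0 < r k → r k ≤ 1 →
      A ⊆ ⋃ x : C, Metric.closedBall (x : X) (r k) ∧
      ∑' _ : C, ((κ * (r k / 2) ^ (d : ℝ) : ℝ≥0) : ℝ≥0∞) ≤ μ k (Metric.thickening (r k) A)) := by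
    intro k
    by_cases h : 0 < r k ∧ r k ≤ 1
    · obtain ⟨C, hC, h1, h2⟩ := exists_countable_cover_tsum_le_measure_thickening (μ k) A h.1
        fun x => hμ k x (r k / 2) (half_pos h.1) ((half_le_self h.1.le).trans h.2)
      exact ⟨C, hC, fun _ _ => ⟨h1, h2⟩⟩
    · exact ⟨∅, countable_empty, fun h1 h2 => absurd ⟨h1, h2⟩ h⟩
  choose C hCc hC using hcov
  have : ∀ k, Countable (C k) := fun k => (hCc k).to_subtype
  -- Covers are taken only at the good scales; a liminf along them already bounds Hausdorff measure.
  set l : Filter ℕ :=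
    atTop ⊓ 𝓟 {k | μ k (Metric.thickening (r k) A) < (r k ^ (s : ℝ) : ℝ≥0)} with hl
  have : l.NeBot := frequently_mem_iff_neBot.1 hfreq
  have hr1 : ∀ᶠ k in atTop, r k ≤ 1 := by
    filter_upwards [(tendsto_order.1 hr0).2 1 one_pos] with k hk
    exact_mod_cast hk.le
  have hdiam : ∀ k (x : C k), Metric.ediam (Metric.closedBall (x : X) (r k)) ≤
      ((2 * r k : ℝ≥0) : ℝ≥0∞) := fun k x => by
    refine Metric.ediam_le fun y hy z hz => ?_
    rw [edist_nndist, ENNReal.coe_le_coe, ← NNReal.coe_le_coe, coe_nndist]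
    push_cast
    rw [Metric.mem_closedBall] at hy hz
    linarith [dist_triangle_right y z x]
  have hH : μH[((d - s : ℝ≥0) : ℝ)] A ≤
      ((2 ^ ((d : ℝ) - s) * 2 ^ (d : ℝ) * κ⁻¹ : ℝ≥0) : ℝ≥0∞) := by
    refine (Measure.hausdorffMeasure_le_liminf_tsum (l := l) _ A
      (fun k => ((2 * r k : ℝ≥0) : ℝ≥0∞)) ?_ (fun k (x : C k) => Metric.closedBall (x : X) (r k))
      (.of_forall hdiam) ?_).trans (liminf_le_of_frequently_le' (Eventually.frequently ?_))
    · have := ENNReal.Tendsto.const_mul (a := 2) hr0 (Or.inr ENNReal.ofNat_ne_top)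
      simp only [mul_zero] at this
      simpa using this.mono_left inf_le_left
    · filter_upwards [hr.filter_mono inf_le_left, hr1.filter_mono inf_le_left] with k h0 h1
      exact (hC k h0 h1).1
    · have hmem : ∀ᶠ k in l, μ k (Metric.thickening (r k) A) < (r k ^ (s : ℝ) : ℝ≥0) :=
        mem_inf_of_right (mem_principal_self _)
      filter_upwards [hr.filter_mono inf_le_left, hr1.filter_mono inf_le_left, hmem]
        with k h0 h1 h2
      have hpow : (2 * r k) ^ ((d : ℝ) - s) = (2 ^ ((d : ℝ) - s) * 2 ^ (d : ℝ) * κ⁻¹ *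
          (r k ^ (s : ℝ))⁻¹) * (κ * (r k / 2) ^ (d : ℝ)) := by
        have : r k ^ (s : ℝ) ≠ 0 := (NNReal.rpow_pos h0).ne'
        have h2 : (2 : ℝ≥0) ^ (d : ℝ) ≠ 0 := (NNReal.rpow_pos two_pos).ne'
        rw [NNReal.mul_rpow, NNReal.div_rpow, NNReal.rpow_sub h0.ne']
        field_simp
      calc ∑' x : C k, Metric.ediam (Metric.closedBall (x : X) (r k)) ^ ((d - s : ℝ≥0) : ℝ)
          ≤ ∑' _ : C k, (((2 * r k) ^ ((d : ℝ) - s) : ℝ≥0) : ℝ≥0∞) := by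
            refine ENNReal.tsum_le_tsum fun x => ?_
            have h0 : 0 ≤ (d : ℝ) - s := sub_nonneg.2 (NNReal.coe_le_coe.2 hsd)
            rw [NNReal.coe_sub hsd, ENNReal.coe_rpow_of_nonneg _ h0]
            exact ENNReal.rpow_le_rpow (hdiam k x) h0
        _ = ((2 ^ ((d : ℝ) - s) * 2 ^ (d : ℝ) * κ⁻¹ * (r k ^ (s : ℝ))⁻¹ : ℝ≥0) : ℝ≥0∞) *
            ∑' _ : C k, ((κ * (r k / 2) ^ (d : ℝ) : ℝ≥0) : ℝ≥0∞) := by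
            rw [hpow, ENNReal.coe_mul, ENNReal.tsum_mul_left]
        _ ≤ ((2 ^ ((d : ℝ) - s) * 2 ^ (d : ℝ) * κ⁻¹ * (r k ^ (s : ℝ))⁻¹ : ℝ≥0) : ℝ≥0∞) *
            (r k ^ (s : ℝ) : ℝ≥0) := by
            gcongr
            exact (hC k h0 h1).2.trans h2.le
        _ = _ := by
            rw [← ENNReal.coe_mul, inv_mul_cancel_right₀ (NNReal.rpow_pos h0).ne']
  refine hA.not_ge ?_
  rw [← ENNReal.coe_sub]
  exact dimH_le_of_hausdorffMeasure_ne_top (ne_top_of_le_ne_top ENNReal.coe_ne_top hH)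

theorem ae_frequently_mem_of_iIndepFun {X Ω : Type*} [MeasurableSpace X] [MeasurableSpace Ω]
    {P : Measure Ω} {η : ℕ → Ω → X} (hη : ∀ k, Measurable (η k)) (hindep : iIndepFun η P)
    {S : ℕ → Set X} (hS : ∀ k, MeasurableSet (S k)) (hsum : ∑' k, P.map (η k) (S k) = ∞) :
    ∀ᵐ ω ∂P, ∃ᶠ k in atTop, η k ω ∈ S k := by
  have : IsProbabilityMeasure P := hindep.isProbabilityMeasure
  have hm : ∀ k, MeasurableSet (η k ⁻¹' S k) := fun k => hη k (hS k)
  have h := measure_limsup_eq_one hm ((iIndepSet_iff_meas_biInter hm).2 fun s =>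
    hindep.measure_inter_preimage_eq_mul s fun i _ => hS i)
    (by simpa only [Measure.map_apply (hη _) (hS _)] using hsum)
  have h' : ∀ᵐ ω ∂P, ω ∈ limsup (fun k => η k ⁻¹' S k) atTop :=
    (prob_compl_eq_zero_iff (MeasurableSet.measurableSet_limsup hm)).2 h
  filter_upwards [h'] with ω hω
  exact mem_limsup_iff_frequently_mem.1 hω

/-- If the laws of the independent points `η k` give mass at least a multiple of `ρ ^ d` to all
balls of radius `ρ ≤ 1`, and `∑ k, r k ^ s = ∞`, then every analytic set of dimension larger than
`d - s` almost surely has a point which lies in infinitely many balls of centre `η k` and radius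
`r k`. -/
theorem ae_exists_mem_frequently_mem_ball {X Ω : Type*} [MetricSpace X]
    [SecondCountableTopology X] [MeasurableSpace X] [BorelSpace X] [MeasurableSpace Ω]
    {P : Measure Ω} {η : ℕ → Ω → X} (hη : ∀ k, Measurable (η k)) (hindep : iIndepFun η P)
    {κ d s : ℝ≥0} (hκ : κ ≠ 0) (hsd : s ≤ d)
    (hball : ∀ k x (ρ : ℝ≥0), 0 < ρ → ρ ≤ 1 → ((κ * ρ ^ (d : ℝ) : ℝ≥0) : ℝ≥0∞) ≤
      P.map (η k) (Metric.ball x ρ))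
    {r : ℕ → ℝ≥0} (hr : ∀ᶠ k in atTop, 0 < r k) (hsum : ¬ Summable fun k => r k ^ (s : ℝ))
    {F : Set X} (hF : AnalyticSet F) (hdim : (d : ℝ≥0∞) - s < dimH F) :
    ∀ᵐ ω ∂P, ∃ x ∈ F, ∃ᶠ k in atTop, x ∈ Metric.ball (η k ω) (r k) := by
  refine ae_exists_mem_frequently_of_lt_dimH (fun _ _ => Metric.isOpen_ball) (fun A hA => ?_) hF
    hdim
  filter_upwards [ae_frequently_mem_of_iIndepFun hη hindep
    (fun k => Metric.isOpen_thickening.measurableSet)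
    (tsum_measure_thickening_eq_top hκ hsd hball hr hsum hA)] with ω hω
  refine hω.mono fun k hk => ?_
  obtain ⟨z, hz, hzk⟩ := Metric.mem_thickening_iff.1 hk
  exact ⟨z, Metric.mem_ball'.2 hzk, hz⟩

/-! ### Volume and dimension estimates on the torus -/

theorem isBounded_torus {d : ℕ} (A : Set (Torus d)) : Bornology.IsBounded A := by
  have : CompactSpace (Torus d) :=
    (PiLp.homeomorph 2 (fun _ : Fin d => UnitAddCircle)).symm.compactSpace
  exact isCompact_univ.isBounded.subset (subset_univ A)

theorem le_uniformTorus_ball {d : ℕ} (x : Torus d) {ρ : ℝ≥0} (hρ : 0 < ρ) (hρ1 : ρ ≤ 1) :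
    ((((d + 1 : ℝ≥0)⁻¹) ^ d * ρ ^ ((d : ℝ≥0) : ℝ) : ℝ≥0) : ℝ≥0∞) ≤
      uniformTorus d (Metric.ball x ρ) := by
  have hρ' : (0 : ℝ) < ρ := hρ
  -- A cube of half-side `ρ / (d + 1)` fits strictly inside the ball, also when `d = 0`.
  have hδ1 : (ρ : ℝ) / (d + 1) ≤ 1 := by
    have : (ρ : ℝ) ≤ 1 := hρ1
    exact div_le_one_of_le₀ (by linarith [(Nat.cast_nonneg d : (0 : ℝ) ≤ d)]) (by positivity)
  have hsub : univ.pi (fun i => Metric.closedBall (x i) ((ρ : ℝ) / (d + 1))) ⊆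
      WithLp.toLp 2 ⁻¹' Metric.ball x ρ := by
    intro y hy
    have hy' : ∀ i, dist (y i) (x i) ≤ (ρ : ℝ) / (d + 1) := fun i => hy i (mem_univ i)
    rw [mem_preimage, Metric.mem_ball, PiLp.dist_eq_of_L2, Real.sqrt_lt' hρ']
    calc ∑ i, dist (y i) (x i) ^ 2 ≤ ∑ _i : Fin d, ((ρ : ℝ) / (d + 1)) ^ 2 :=
          Finset.sum_le_sum fun i _ => pow_le_pow_left₀ dist_nonneg (hy' i) 2
      _ = (d / (d + 1) ^ 2) * (ρ : ℝ) ^ 2 := by simp; field_simp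
      _ < 1 * (ρ : ℝ) ^ 2 := by
          gcongr
          rw [div_lt_one (by positivity)]
          nlinarith [(Nat.cast_nonneg d : (0 : ℝ) ≤ d)]
      _ = (ρ : ℝ) ^ 2 := one_mul _
  calc ((((d + 1 : ℝ≥0)⁻¹) ^ d * ρ ^ ((d : ℝ≥0) : ℝ) : ℝ≥0) : ℝ≥0∞)
      = ∏ _i : Fin d, ENNReal.ofReal ((ρ : ℝ) / (d + 1)) := by
        have : ENNReal.ofReal ((ρ : ℝ) / (d + 1)) = (((d + 1 : ℝ≥0)⁻¹ * ρ : ℝ≥0) : ℝ≥0∞) := by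
          rw [← ENNReal.ofReal_coe_nnreal]
          congr 1
          push_cast
          ring
        rw [Finset.prod_const, Finset.card_univ, Fintype.card_fin, this, ← ENNReal.coe_pow, mul_pow,
          NNReal.coe_natCast, NNReal.rpow_natCast]
    _ ≤ ∏ i, (volume : Measure UnitAddCircle)
        (Metric.closedBall (x i) ((ρ : ℝ) / (d + 1))) := by
        refine Finset.prod_le_prod' fun i _ => ?_
        rw [AddCircle.volume_closedBall]
        refine ENNReal.ofReal_le_ofReal (le_min hδ1 ?_)
        have : 0 ≤ (ρ : ℝ) / (d + 1) := by positivity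
        linarith
    _ = volume (univ.pi fun i => Metric.closedBall (x i) ((ρ : ℝ) / (d + 1))) := by
        rw [volume_pi, Measure.pi_pi]
    _ ≤ volume (WithLp.toLp 2 ⁻¹' Metric.ball x ρ) := measure_mono hsub
    _ = uniformTorus d (Metric.ball x ρ) := by
        rw [uniformTorus, Measure.map_apply (WithLp.measurable_toLp _ _) measurableSet_ball]

/-- Each tail of the translates covers the limsup set, and the tails of a convergent sum tend to
zero. This holds for every choice of translations. -/
theorem dimH_coveringSet_le {d : ℕ} (g : ℕ → Set (Torus d)) (x : ℕ → Torus d) {s : ℝ≥0}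
    (hs : 0 < s) (hsum : Summable fun n => Metric.diam (g n) ^ (s : ℝ)) :
    dimH (coveringSet g x) ≤ s := by
  have hs' : (0 : ℝ) < s := hs
  set l : ℕ → ℝ≥0∞ := fun n => Metric.ediam (g n) with hl
  have hlp : ∀ n, l n ^ (s : ℝ) = ENNReal.ofReal (Metric.diam (g n) ^ (s : ℝ)) := fun n => by
    rw [← ENNReal.ofReal_rpow_of_nonneg Metric.diam_nonneg hs'.le, Metric.diam,
      ENNReal.ofReal_toReal (isBounded_torus _).ediam_ne_top]
  have htop : ∑' n, l n ^ (s : ℝ) ≠ ∞ := by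
    simp only [hlp]
    exact hsum.tsum_ofReal_ne_top
  have htail := ENNReal.tendsto_sum_nat_add (fun n => l n ^ (s : ℝ)) htop
  have hle : ∀ n i, l (i + n) ≤ (∑' k, l (k + n) ^ (s : ℝ)) ^ (s : ℝ)⁻¹ := fun n i => by
    rw [ENNReal.le_rpow_inv_iff hs']
    exact ENNReal.le_tsum i
  have htail' : Tendsto (fun n => (∑' k, l (k + n) ^ (s : ℝ)) ^ (s : ℝ)⁻¹) atTop (𝓝 0) := by
    have := htail.ennrpow_const (s : ℝ)⁻¹
    rwa [ENNReal.zero_rpow_of_pos (inv_pos.2 hs')] at this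
  have hdiam : ∀ n i, Metric.ediam ((fun y => y + x (i + n)) '' g (i + n)) = l (i + n) :=
    fun n i => (IsometryEquiv.addRight (x (i + n))).isometry.ediam_image _
  have hH := Measure.hausdorffMeasure_le_liminf_tsum (s : ℝ) (coveringSet g x) (l := atTop) _ htail'
    (fun n i => (fun y => y + x (i + n)) '' g (i + n))
    (.of_forall fun n i => (hdiam n i).trans_le (hle n i)) (.of_forall fun n y hy => by
      obtain ⟨k, hk, hyk⟩ := mem_iUnion₂.1 (mem_iInter.1 hy n)
      refine mem_iUnion.2 ⟨k - n, ?_⟩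
      rwa [Nat.sub_add_cancel hk])
  simp only [hdiam] at hH
  rw [htail.liminf_eq] at hH
  exact dimH_le_of_hausdorffMeasure_ne_top (ne_top_of_le_ne_top ENNReal.zero_ne_top hH)

/-! ### Balls inside the covering sets -/

theorem inradius_nonneg {d : ℕ} (A : Set (Torus d)) : 0 ≤ inradius A :=
  Real.sSup_nonneg fun _ h => h.1

theorem exists_ball_half_inradius_subset {d : ℕ} (A : Set (Torus d)) :
    ∃ c, Metric.ball c (inradius A / 2) ⊆ A := by
  rcases (inradius_nonneg A).eq_or_lt with h | h
  · exact ⟨0, by simp [← h]⟩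
  · have hne : {r : ℝ | 0 ≤ r ∧ r ≤ Metric.diam (univ : Set (Torus d)) ∧
        ∃ c, Metric.ball c r ⊆ A}.Nonempty := by
      rw [nonempty_iff_ne_empty]
      intro h0
      rw [inradius, h0, Real.sSup_empty] at h
      exact h.false
    obtain ⟨r, ⟨-, -, c, hc⟩, hr⟩ := exists_lt_of_lt_csSup hne (half_lt_self h)
    exact ⟨c, (Metric.ball_subset_ball hr.le).trans hc⟩

theorem not_summable_of_eventually_le_mul {f : ℕ → ℝ} {r : ℕ → ℝ≥0} {s K : ℝ}
    (hf : ∀ n, 0 ≤ f n) (hfr : ∀ᶠ n in atTop, f n ≤ K * (r n : ℝ) ^ s) (hsum : ¬ Summable f) :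
    ¬ Summable fun n => r n ^ s := by
  intro h
  have h' : Summable fun n => (r n : ℝ) ^ s := by exact_mod_cast NNReal.summable_coe.2 h
  refine hsum (Summable.of_norm_bounded_eventually_nat (h'.mul_left K) ?_)
  filter_upwards [hfr] with n hn
  rwa [Real.norm_of_nonneg (hf n)]

theorem IsBallSequence.exists_balls {d : ℕ} {g : ℕ → Set (Torus d)} (hg : IsBallSequence g)
    {s : ℝ≥0} (hsum : ¬ Summable fun n => Metric.diam (g n) ^ (s : ℝ)) :
    ∃ (c : ℕ → Torus d) (r : ℕ → ℝ≥0), (∀ n, Metric.ball (c n) (r n) ⊆ g n) ∧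
      (∀ᶠ n in atTop, 0 < r n) ∧ ¬ Summable fun n => r n ^ (s : ℝ) := by
  choose r hr hgr using hg
  refine ⟨fun _ => 0, fun n => .mk (r n) (hr n).le, fun n => ?_, .of_forall hr,
    not_summable_of_eventually_le_mul (K := 2 ^ (s : ℝ))
      (fun n => Real.rpow_nonneg Metric.diam_nonneg _) (.of_forall fun n => ?_) hsum⟩
  · rcases hgr n with h | h <;> rw [h]
    · exact subset_rfl
    · exact Metric.ball_subset_closedBall
  · have hd : Metric.diam (g n) ≤ 2 * r n := by
      refine Metric.diam_le_of_subset_closedBall (x := 0) (hr n).le ?_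
      rcases hgr n with h | h <;> rw [h]
      exact Metric.ball_subset_closedBall
    rw [NNReal.coe_mk, ← Real.mul_rpow zero_le_two (hr n).le]
    exact Real.rpow_le_rpow Metric.diam_nonneg hd s.2

theorem rpow_le_mul_rpow_of_log_div_log {l I M s q : ℝ} (hl : 0 ≤ l) (hI : 0 ≤ I) (hs : 0 ≤ s)
    (hq : 0 < q) (hM : 1 ≤ M) (hlM : l ≤ M) (h0 : 0 < Real.log I / Real.log l)
    (h1 : Real.log I / Real.log l < q⁻¹) : 0 < I ∧ l ^ s ≤ M ^ s * I ^ (s * q) := by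
  -- Since `log 0 = 0` and `x / 0 = 0`, a positive ratio excludes `l = 0`, `l = 1` and `I = 0`.
  have hl0 : Real.log l ≠ 0 := fun h => by simp [h] at h0
  have hI0 : Real.log I ≠ 0 := fun h => by simp [h] at h0
  have hlpos : 0 < l := hl.lt_of_ne fun h => hl0 (by simp [← h])
  have hIpos : 0 < I := hI.lt_of_ne fun h => hI0 (by simp [← h])
  refine ⟨hIpos, ?_⟩
  rcases hl0.lt_or_gt with hneg | hpos
  · have h2 : q⁻¹ * Real.log l < Real.log I := (div_lt_iff_of_neg hneg).1 h1
    have h3 : Real.log l ≤ q * Real.log I := by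
      have := mul_le_mul_of_nonneg_left h2.le hq.le
      rwa [mul_inv_cancel_left₀ hq.ne'] at this
    calc l ^ s ≤ I ^ (s * q) := by
          rw [Real.rpow_def_of_pos hlpos, Real.rpow_def_of_pos hIpos, Real.exp_le_exp]
          nlinarith
      _ ≤ M ^ s * I ^ (s * q) :=
          le_mul_of_one_le_left (Real.rpow_nonneg hI _) (Real.one_le_rpow hM hs)
  · have h2 : 0 < Real.log I := by
      have := mul_pos h0 hpos
      rwa [div_mul_cancel₀ _ hl0] at this
    have hI1 : 1 ≤ I := ((Real.log_pos_iff hI).1 h2).le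
    calc l ^ s ≤ M ^ s := Real.rpow_le_rpow hl hlM hs
      _ ≤ M ^ s * I ^ (s * q) :=
          le_mul_of_one_le_right (by positivity) (Real.one_le_rpow hI1 (by positivity))

theorem IsBallLikeSequence.exists_balls {d : ℕ} {g : ℕ → Set (Torus d)}
    (hg : IsBallLikeSequence g) {s q : ℝ≥0} (hq : 0 < q) (hq1 : q < 1)
    (hsum : ¬ Summable fun n => Metric.diam (g n) ^ (s : ℝ)) :
    ∃ (c : ℕ → Torus d) (r : ℕ → ℝ≥0), (∀ n, Metric.ball (c n) (r n) ⊆ g n) ∧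
      (∀ᶠ n in atTop, 0 < r n) ∧ ¬ Summable fun n => r n ^ ((s * q : ℝ≥0) : ℝ) := by
  choose c hc using fun n => exists_ball_half_inradius_subset (g n)
  set M := max 1 (Metric.diam (univ : Set (Torus d)))
  have hI := fun n => inradius_nonneg (g n)
  have hq' : (0 : ℝ) < q := hq
  have key : ∀ᶠ n in atTop, 0 < inradius (g n) ∧ Metric.diam (g n) ^ (s : ℝ) ≤
      M ^ (s : ℝ) * inradius (g n) ^ ((s : ℝ) * q) := by
    have h := tendsto_order.1 hg
    filter_upwards [h.1 0 one_pos, h.2 (q : ℝ)⁻¹ (one_lt_inv₀ hq' |>.2 hq1)] with n h0 h1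
    exact rpow_le_mul_rpow_of_log_div_log Metric.diam_nonneg (hI n) s.2 hq' (le_max_left _ _)
      ((Metric.diam_mono (subset_univ _) (isBounded_torus _)).trans (le_max_right _ _)) h0 h1
  refine ⟨c, fun n => .mk (inradius (g n) / 2) (by linarith [hI n]), hc, ?_,
    not_summable_of_eventually_le_mul (K := M ^ (s : ℝ) * 2 ^ ((s : ℝ) * q))
      (fun n => Real.rpow_nonneg Metric.diam_nonneg _) ?_ hsum⟩
  · filter_upwards [key] with n hn
    exact half_pos hn.1
  · filter_upwards [key] with n hn
    rw [NNReal.coe_mul, mul_assoc, NNReal.coe_mk,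
      ← Real.mul_rpow zero_le_two (by linarith [hI n]), mul_div_cancel₀ _ two_ne_zero]
    exact hn.2

/-- Ball-likeness costs a factor `q < 1` in the exponent; the strict inequality leaves room for `q`
near `1`. -/
theorem exists_balls_of_isBallSequence_or_isBallLikeSequence {d : ℕ} {g : ℕ → Set (Torus d)}
    (hg : IsBallSequence g ∨ IsBallLikeSequence g) {s : ℝ≥0} (hsd : s ≤ d) {D : ℝ≥0∞}
    (hD : (d : ℝ≥0∞) - s < D) (hsum : ¬ Summable fun n => Metric.diam (g n) ^ (s : ℝ)) :
    ∃ (c : ℕ → Torus d) (r : ℕ → ℝ≥0) (s' : ℝ≥0), s' ≤ d ∧ (d : ℝ≥0∞) - s' < D ∧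
      (∀ n, Metric.ball (c n) (r n) ⊆ g n) ∧ (∀ᶠ n in atTop, 0 < r n) ∧
      ¬ Summable fun n => r n ^ (s' : ℝ) := by
  rcases hg with hg | hg
  · obtain ⟨c, r, h⟩ := hg.exists_balls hsum
    exact ⟨c, r, s, hsd, hD, h⟩
  · have hlim : Tendsto (fun q : ℝ≥0 => (d : ℝ≥0∞) - ((s * q : ℝ≥0) : ℝ≥0∞)) (𝓝[<] 1)
        (𝓝 ((d : ℝ≥0∞) - s)) := by
      have : Tendsto (fun q : ℝ≥0 => ((s * q : ℝ≥0) : ℝ≥0∞)) (𝓝[<] 1) (𝓝 s) := by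
        refine ENNReal.tendsto_coe.2 (tendsto_nhdsWithin_of_tendsto_nhds ?_)
        simpa using (continuous_const_mul s).tendsto 1
      exact ENNReal.Tendsto.sub tendsto_const_nhds this (Or.inl (ENNReal.natCast_ne_top d))
    have : (𝓝[<] (1 : ℝ≥0)).NeBot := nhdsLT_neBot_of_exists_lt ⟨0, one_pos⟩
    obtain ⟨q, hqD, hq⟩ := ((hlim.eventually_lt_const hD).and
      (Ioo_mem_nhdsLT (one_pos : (0 : ℝ≥0) < 1))).exists
    obtain ⟨c, r, h⟩ := hg.exists_balls hq.1 hq.2 hsum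
    exact ⟨c, r, s * q, (mul_le_of_le_one_right' hq.2.le).trans hsd, hqD, h⟩

/-! ### The covering exponent and the conclusion -/

theorem exists_lt_of_sub_coveringExponent_lt {d : ℕ} {l : ℕ → ℝ} {D : ℝ≥0∞}
    (h : (d : ℝ≥0∞) - coveringExponent d l < D) :
    ∃ s : ℝ≥0, s ≤ d ∧ ¬ Summable (fun n => l n ^ (s : ℝ)) ∧ (d : ℝ≥0∞) - s < D := by
  by_contra! hcon
  -- The exponent `0` always qualifies: the constant series `1` diverges, as `0 ^ 0 = 1`.
  have h0 : D ≤ d := by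
    simpa using hcon 0 zero_le (by simp [summable_const_iff])
  have hle : coveringExponent d l ≤ d - D := by
    refine iSup₂_le fun s hs => ?_
    have hs1 : (s : ℝ≥0∞) ≤ d := by exact_mod_cast ENNReal.coe_le_coe.2 hs.1
    have := hcon s hs.1 hs.2
    exact ENNReal.le_sub_of_add_le_left (ne_top_of_le_ne_top (ENNReal.natCast_ne_top d) h0)
      ((add_le_add_left this _).trans_eq (tsub_add_cancel_of_le hs1))
  refine h.not_ge ?_
  calc D = d - (d - D) := (ENNReal.sub_sub_cancel (ENNReal.natCast_ne_top d) h0).symm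
    _ ≤ _ := tsub_le_tsub_left hle _

theorem sub_coveringExponent_le_of_dimH_coveringSet {d : ℕ} (g : ℕ → Set (Torus d))
    (x : ℕ → Torus d) : (d : ℝ≥0∞) - coveringExponent d (fun n => Metric.diam (g n)) ≤
      d - dimH (coveringSet g x) := by
  set β := coveringExponent d (fun n => Metric.diam (g n)) with hβ
  rcases le_or_gt (d : ℝ≥0∞) β with h | h
  · simp [tsub_eq_zero_of_le h]
  refine tsub_le_tsub_left (le_of_forall_gt_imp_ge_of_dense fun t ht => ?_) _
  obtain ⟨s, hβs, hs⟩ := ENNReal.lt_iff_exists_nnreal_btwn.1 (lt_min ht h)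
  have hsd : s ≤ d := by exact_mod_cast (hs.le.trans (min_le_right _ _))
  have hsum : Summable fun n => Metric.diam (g n) ^ (s : ℝ) := by
    by_contra hns
    exact hβs.not_ge (le_iSup₂_of_le (f := fun (s : ℝ≥0) _ => (s : ℝ≥0∞)) s ⟨hsd, hns⟩ le_rfl)
  exact (dimH_coveringSet_le g x (ENNReal.coe_pos.1 (pos_of_gt hβs)) hsum).trans
    (hs.le.trans (min_le_left _ _))

theorem ae_coveringSet_inter_nonempty {d : ℕ} {Ω : Type*} [MeasurableSpace Ω] (P : Measure Ω)
    (g : ℕ → Set (Torus d)) (hg : IsBallSequence g ∨ IsBallLikeSequence g)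
    (ξ : ℕ → Ω → Torus d) (hξ_meas : ∀ n, Measurable (ξ n)) (hξ_indep : iIndepFun ξ P)
    (hξ_unif : ∀ n, P.map (ξ n) = uniformTorus d) {F : Set (Torus d)} (hF : AnalyticSet F)
    (hdim : (d : ℝ≥0∞) - coveringExponent d (fun n => Metric.diam (g n)) < dimH F) :
    ∀ᵐ ω ∂P, (coveringSet g (fun n => ξ n ω) ∩ F).Nonempty := by
  obtain ⟨s₀, hs₀, hsum₀, hD₀⟩ := exists_lt_of_sub_coveringExponent_lt hdim
  obtain ⟨c, r, s, hsd, hD, hcr, hr, hsum⟩ :=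
    exists_balls_of_isBallSequence_or_isBallLikeSequence hg hs₀ hD₀ hsum₀
  have hadd : ∀ k, Measurable fun y : Torus d => y + c k := fun k => measurable_add_const _
  have hball : ∀ k x (ρ : ℝ≥0), 0 < ρ → ρ ≤ 1 →
      ((((d + 1 : ℝ≥0)⁻¹) ^ d * ρ ^ ((d : ℝ≥0) : ℝ) : ℝ≥0) : ℝ≥0∞) ≤
        P.map (fun ω => ξ k ω + c k) (Metric.ball x ρ) := fun k x ρ hρ hρ1 => by
    -- The lower bound is uniform in the centre, so the shift by `c k` is moved onto the ball.
    have h : P.map (fun ω => ξ k ω + c k) = (uniformTorus d).map fun y => y + c k := by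
      rw [← hξ_unif k, Measure.map_map (hadd k) (hξ_meas k)]
      rfl
    rw [h, Measure.map_apply (hadd k) measurableSet_ball]
    refine (le_uniformTorus_ball (x - c k) hρ hρ1).trans (measure_mono fun y hy => ?_)
    rw [mem_preimage, Metric.mem_ball, dist_eq_norm] at *
    rwa [← sub_sub_eq_add_sub]
  filter_upwards [ae_exists_mem_frequently_mem_ball (fun k => (hadd k).comp (hξ_meas k))
    (hξ_indep.comp (fun k y => y + c k) hadd) (by positivity) hsd hball hr hsum hF
    (by simpa using hD)] with ω ⟨x, hxF, hx⟩
  refine ⟨x, mem_iInter.2 fun n => ?_, hxF⟩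
  obtain ⟨k, hk, hxk⟩ := frequently_atTop.1 hx n
  refine mem_iUnion₂.2 ⟨k, hk, x - ξ k ω, hcr k ?_, sub_add_cancel x (ξ k ω)⟩
  rw [Metric.mem_ball, dist_eq_norm] at hxk ⊢
  simpa [sub_sub] using hxk

theorem theorem1 {d : ℕ} {Ω : Type*} [MeasurableSpace Ω] (P : Measure Ω) [IsProbabilityMeasure P]
    (g : ℕ → Set (Torus d)) (hg : IsBallSequence g ∨ IsBallLikeSequence g)
    (ξ : ℕ → Ω → Torus d) (hξ_meas : ∀ n, Measurable (ξ n)) (hξ_indep : iIndepFun ξ P)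
    (hξ_unif : ∀ n, P.map (ξ n) = uniformTorus d)
    (F : Set (Torus d)) (hF : AnalyticSet F) :
    (∀ α : ℝ≥0∞, (∀ᵐ ω ∂P, dimH (coveringSet g (fun n => ξ n ω)) = α) →
      (d : ℝ≥0∞) - α < dimH F →
      ∀ᵐ ω ∂P, (coveringSet g (fun n => ξ n ω) ∩ F).Nonempty) ∧
    ((d : ℝ≥0∞) - coveringExponent d (fun n => Metric.diam (g n)) < dimH F →
      ∀ᵐ ω ∂P, (coveringSet g (fun n => ξ n ω) ∩ F).Nonempty) := by
  have main := ae_coveringSet_inter_nonempty P g hg ξ hξ_meas hξ_indep hξ_unif hF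
  refine ⟨fun α hα hlt => main ?_, main⟩
  obtain ⟨ω, rfl⟩ := hα.exists
  exact (sub_coveringExponent_le_of_dimH_coveringSet g _).trans_lt hlt
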